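/- For a group $G$ generated by a finite set $S$, let $\|g\|_S$ be the word length of $g\in G$ with respect to $S$ (the least length of a word in $S\cup S^{-1}$ representing $g$). For $g\neq 1$ let $$k_G(g)=\min\{|G/N| : N\trianglelefteq G \text{ of finite index},\ g\notin N\}$$ be the least order of a finite quotient of $G$ in which $g$ has nontrivial image, and put $$F_G^S(n)=\max\{k_G(g) : g\neq 1,\ \|g\|_S\le n\}$$ (with $F_G^S(n)=0$ if there is no such $g$). For functions $f_1,f_2$ write $f_1\preceq f_2$ (equivalently $f_2\succeq f_1$) if there is a positive integer $C$ with $f_1(n)\le C f_2(Cn)$ for all integers $n\ge 1$. Let $T$ be the rooted binary tree of finite sequences of $0$s and $1$s, and let $a,b,c,d$ be the automorphisms of $T$ that fix the empty sequence and are given recursively on a sequence with first entry $x\in\{0,1\}$ and remaining (possibly empty) part $w$ by $$a(x,w)=(1-x,w),\quad b(0,w)=(0,a(w)),\ b(1,w)=(1,c(w)),$$ $$c(0,w)=(0,a(w)),\ c(1,w)=(1,d(w)),\quad d(0,w)=(0,w),\ d(1,w)=(1,b(w)).$$ Let $\Gamma=\langle a,b,c,d\rangle\le \mathrm{Aut}(T)$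 be the first Grigorchuk group. **Theorem.** For every finite generating set $S$ of $\Gamma$, $$F_\Gamma^S(n)\succeq 2^n .$$ -/

import Mathlib

namespace ResidualGrowth

/-! Residual finiteness growth of a group with respect to a finite generating set. -/

/-- The word length of `g` with respect to `S`: the least length of a product of elements of `S`
and inverses of elements of `S` that equals `g` (meaningful for `g` in the subgroup generated
by `S`). -/
noncomputable def wordLength {G : Type*} [Group G] (S : Set G) (g : G) : ℕ :=
  sInf {m | ∃ l : List G, (∀ x ∈ l, x ∈ S ∨ x⁻¹ ∈ S) ∧ l.prod = g ∧ l.length = m}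

/-- `k_G(g)`: the least order of a finite quotient of `G` in which the image of `g` is nontrivial
(meaningful for `g ≠ 1` in a residually finite group). -/
noncomputable def minQuotientCard {G : Type*} [Group G] (g : G) : ℕ :=
  sInf {m | ∃ N : Subgroup G, N.Normal ∧ N.FiniteIndex ∧ g ∉ N ∧ Nat.card (G ⧸ N) = m}

/-- `F_G^S(n)`: the maximum of `k_G(g)` over the nontrivial elements `g` of word length at most
`n` (and `0` if there are none). The maximum exists, see `bddAbove_minQuotientCard`. -/
noncomputable def rfGrowth {G : Type*} [Group G] (S : Set G) (n : ℕ) : ℕ :=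
  sSup {m | ∃ g : G, g ≠ 1 ∧ wordLength S g ≤ n ∧ minQuotientCard g = m}

/-- `f₁ ≼ f₂`: there is a constant `C` with `f₁(n) ≤ C f₂(C n)` for all positive integers `n`. -/
def GrowthLE (f₁ f₂ : ℕ → ℕ) : Prop :=
  ∃ C : ℕ, 0 < C ∧ ∀ n : ℕ, 1 ≤ n → f₁ n ≤ C * f₂ (C * n)

theorem exists_word {G : Type*} [Group G] {S : Set G} (hS : Subgroup.closure S = ⊤) (g : G) :
    ∃ l : List G, (∀ x ∈ l, x ∈ S ∨ x⁻¹ ∈ S) ∧ l.prod = g ∧ l.length = wordLength S g := by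
  apply Nat.sInf_mem (s := {m | ∃ l : List G, (∀ x ∈ l, x ∈ S ∨ x⁻¹ ∈ S) ∧ l.prod = g ∧
    l.length = m})
  have hg : g ∈ Subgroup.closure S := hS ▸ Subgroup.mem_top g
  rw [← Subgroup.mem_toSubmonoid, Subgroup.closure_toSubmonoid] at hg
  obtain ⟨l, hl, hp⟩ := Submonoid.exists_list_of_mem_closure hg
  exact ⟨l.length, l, hl, hp, rfl⟩

theorem finite_ball {G : Type*} [Group G] {S : Set G} (hfin : S.Finite)
    (hS : Subgroup.closure S = ⊤) (n : ℕ) : {g : G | wordLength S g ≤ n}.Finite := by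
  have hA : (S ∪ S⁻¹).Finite := hfin.union hfin.inv
  have : Finite ↥(S ∪ S⁻¹) := hA
  refine ((List.finite_length_le ↥(S ∪ S⁻¹) n).image
    (fun l => (l.map Subtype.val).prod)).subset ?_
  intro g hg
  obtain ⟨l, hl, hp, hlen⟩ := exists_word hS g
  have hl' : ∀ x ∈ l, x ∈ S ∪ S⁻¹ := fun x hx => hl x hx
  refine ⟨l.attach.map (fun x => ⟨x.1, hl' x.1 x.2⟩), ?_, ?_⟩
  · have : l.length ≤ n := hlen ▸ hg
    simpa using this
  · simp [List.map_map, Function.comp_def, hp]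

/-- For a finite generating set, the set whose supremum defines `rfGrowth` is bounded, so that
the supremum is a maximum as soon as the set is nonempty. -/
theorem bddAbove_minQuotientCard {G : Type*} [Group G] {S : Set G} (hfin : S.Finite)
    (hS : Subgroup.closure S = ⊤) (n : ℕ) :
    BddAbove {m | ∃ g : G, g ≠ 1 ∧ wordLength S g ≤ n ∧ minQuotientCard g = m} := by
  refine (((finite_ball hfin hS n).image minQuotientCard).subset ?_).bddAbove
  rintro m ⟨g, -, hg, rfl⟩
  exact ⟨g, hg, rfl⟩

end ResidualGrowth

namespace Grigorchuk

/-! The first Grigorchuk group, acting on the rooted binary tree. The vertices of the tree are the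
finite sequences of bits, `List Bool`, with `false` for `0` and `true` for `1`. -/

/-- Names of the four standard generators. -/
inductive Letter : Type
  | a | b | c | d

/-- The action of the generators on finite sequences:
`a` flips the first bit, `b = (a, c)`, `c = (a, d)`, `d = (1, b)`. -/
def Letter.act : Letter → List Bool → List Bool
  | _, [] => []
  | .a, x :: w => (!x) :: w
  | .b, false :: w => false :: Letter.act .a w
  | .b, true :: w => true :: Letter.act .c w
  | .c, false :: w => false :: Letter.act .a w
  | .c, true :: w => true :: Letter.act .d w
  | .d, false :: w => false :: w
  | .d, true :: w => true :: Letter.act .b w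

theorem Letter.act_involutive (s : Letter) : Function.Involutive s.act := by
  intro w
  induction w generalizing s with
  | nil => cases s <;> rfl
  | cons x w ih => cases s <;> cases x <;> simp [Letter.act, ih]

/-- A generator as a permutation of the vertices of the tree. -/
def Letter.perm (s : Letter) : Equiv.Perm (List Bool) :=
  s.act_involutive.toPerm

/-- The automorphism group of the rooted binary tree, as a group of permutations of its vertices:
the permutations that preserve the length of a sequence and the relation of being a prefix. -/
def treeAut : Subgroup (Equiv.Perm (List Bool)) where
  carrier := {σ | (∀ u, (σ u).length = u.length) ∧ ∀ u v, σ u <+: σ v ↔ u <+: v}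
  mul_mem' := by
    rintro σ τ ⟨h1, h2⟩ ⟨h3, h4⟩
    exact ⟨fun u => by simp [h1, h3], fun u v => by simp [h2, h4]⟩
  one_mem' := by simp
  inv_mem' := by
    rintro σ ⟨h1, h2⟩
    exact ⟨fun u => by simpa using (h1 (σ⁻¹ u)).symm,
      fun u v => by simpa using (h2 (σ⁻¹ u) (σ⁻¹ v)).symm⟩

/-- The first Grigorchuk group `Γ = ⟨a, b, c, d⟩`, as a group of permutations of the vertices of
the rooted binary tree (all of them tree automorphisms, see `firstGroup_le_treeAut`). -/
def firstGroup : Subgroup (Equiv.Perm (List Bool)) :=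
  Subgroup.closure (Set.range Letter.perm)

theorem Letter.act_prefix (s : Letter) {u v : List Bool} (h : u <+: v) : s.act u <+: s.act v := by
  induction u generalizing s v with
  | nil => cases s <;> simp [Letter.act]
  | cons x u ih =>
    cases v with
    | nil => simp at h
    | cons y v =>
      obtain ⟨rfl, h2⟩ := List.cons_prefix_cons.1 h
      cases s <;> cases x <;> simp [Letter.act, List.cons_prefix_cons, h2, ih]

theorem firstGroup_le_treeAut : firstGroup ≤ treeAut := by
  refine (Subgroup.closure_le _).2 ?_
  rintro _ ⟨s, rfl⟩
  refine ⟨fun u => ?_, fun u v => ⟨fun h => ?_, fun h => s.act_prefix h⟩⟩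
  · change (s.act u).length = u.length
    induction u generalizing s with
    | nil => cases s <;> rfl
    | cons x u ih => cases s <;> cases x <;> simp [Letter.act, ih]
  · have := s.act_prefix h
    simpa [Letter.perm, s.act_involutive u, s.act_involutive v] using this

end Grigorchuk

/-! ### Word length and residual growth. -/

namespace ResidualGrowth

section WordLength

variable {G : Type*} [Group G] {S : Set G}

/-! Let x, y be non-commuting elements of Γ supported below one vertex of level k, of word length
O(2^k). Level transitivity gives conjugates x_v, y_v below each of the 2^k vertices v of that level.
For v ≠ w the supports of x_v and y_w are disjoint, so these commute, while [x_v, y_v] is conjugate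
to [x, y]. In a finite quotient where [x, y] survives, adding the y_v one at a time strictly shrinks
the centralizer 2^k times, so the order is at least 2^(2^k) (`two_pow_card_le_of_commute_iff`).

Such short x, y come from `subst`: its values act on the right half of the tree as the original
word, and on the left half through ⟨a, d⟩, of exponent dividing 4. Iterated on a fourth power it
leaves only the action below 1^k (`eval_iterate_subst_pow_four`), and it merely doubles lengths
(`length_iterate_subst`). The seeds are (ab)⁴ and (ac)⁴. -/

theorem wordLength_le_length {l : List G} (hl : ∀ x ∈ l, x ∈ S ∨ x⁻¹ ∈ S) :
    wordLength S l.prod ≤ l.length :=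
  Nat.sInf_le ⟨l, hl, rfl, rfl⟩

theorem wordLength_one_le : wordLength S 1 ≤ 0 := by
  simpa using wordLength_le_length (S := S) (l := []) (by simp)

theorem wordLength_mul_le (hS : Subgroup.closure S = ⊤) (g h : G) :
    wordLength S (g * h) ≤ wordLength S g + wordLength S h := by
  obtain ⟨l, hl, rfl, hlen⟩ := exists_word hS g
  obtain ⟨m, hm, rfl, hmlen⟩ := exists_word hS h
  rw [← hlen, ← hmlen, ← List.prod_append, ← List.length_append]
  refine wordLength_le_length fun x hx => ?_
  rcases List.mem_append.1 hx with hx | hx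
  exacts [hl x hx, hm x hx]

theorem wordLength_prod_le (hS : Subgroup.closure S = ⊤) {L : ℕ} (l : List G)
    (hl : ∀ x ∈ l, wordLength S x ≤ L) : wordLength S l.prod ≤ L * l.length := by
  induction l with
  | nil => simpa using wordLength_one_le (S := S)
  | cons x l ih =>
    have h1 := hl x (by simp)
    have h2 := ih fun y hy => hl y (by simp [hy])
    have h3 := wordLength_mul_le hS x l.prod
    rw [List.prod_cons, List.length_cons, mul_add]
    lia

/-- Boundedness matters: the supremum of an unbounded set of naturals is `0`. -/
theorem le_rfGrowth (hfin : S.Finite) (hS : Subgroup.closure S = ⊤) {g : G} (hg : g ≠ 1) {n : ℕ}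
    (hn : wordLength S g ≤ n) : minQuotientCard g ≤ rfGrowth S n :=
  le_csSup (bddAbove_minQuotientCard hfin hS n) ⟨g, hg, hn, rfl⟩

end WordLength

/-- If `y i` commutes with `x j` exactly when `i ≠ j`, then the centralizers of finite sets of
the `y i` form strictly decreasing chains, which bounds the order of the group from below. -/
theorem two_pow_card_le_of_commute_iff {Q ι : Type*} [Group Q] [Finite Q] [Fintype ι]
    (x y : ι → Q) (hne : ∀ i j, i ≠ j → Commute (x i) (y j)) (hself : ∀ i, ¬ Commute (x i) (y i)) :
    2 ^ Fintype.card ι ≤ Nat.card Q := by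
  classical
  have key : ∀ s : Finset ι,
      2 ^ s.card * Nat.card (Subgroup.centralizer (y '' (s : Set ι))) ≤ Nat.card Q := by
    intro s
    induction s using Finset.induction_on with
    | empty =>
      rw [Finset.card_empty, pow_zero, one_mul]
      exact Subgroup.card_le_card_group _
    | insert i s hi ih =>
      set H := Subgroup.centralizer (y '' (s : Set ι))
      set K := Subgroup.centralizer (y '' ((insert i s : Finset ι) : Set ι))
      have hKH : K ≤ H := Subgroup.centralizer_le (Set.image_mono (by simp))
      -- `x i` separates the two centralizers, so by Lagrange the index of `K` in `H` is at least 2.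
      have hx : x i ∈ H := by
        rintro _ ⟨j, hj, rfl⟩
        exact (hne i j fun h => hi (h ▸ hj)).symm
      have hx' : x i ∉ K := fun h => hself i (h (y i) ⟨i, by simp, rfl⟩).symm
      have hdvd : Nat.card K ∣ Nat.card H := Subgroup.card_dvd_of_le hKH
      obtain ⟨m, hm⟩ := hdvd
      have hpos : 0 < Nat.card H := Nat.card_pos
      have hm2 : 2 ≤ m := by
        by_contra hlt
        have hm1 : m = 1 := by
          have : m ≠ 0 := by
            rintro rfl
            rw [mul_zero] at hm
            exact hpos.ne' hm
          lia
        have : K = H := Subgroup.eq_of_le_of_card_ge hKH (by rw [hm, hm1, mul_one])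
        exact hx' (this ▸ hx)
      rw [Finset.card_insert_of_notMem hi, pow_succ, mul_assoc]
      refine le_trans (Nat.mul_le_mul_left _ ?_) ih
      rw [hm, mul_comm]
      exact Nat.mul_le_mul_left _ hm2
  have h := key Finset.univ
  rw [Finset.card_univ] at h
  exact le_trans (Nat.le_mul_of_pos_right _ Nat.card_pos) h

end ResidualGrowth

/-! ### Words, the substitution and its action on the two halves of the tree. -/

namespace Grigorchuk

open ResidualGrowth
open scoped commutatorElement

/-- A generator as an element of the first Grigorchuk group. -/
def Letter.elem (s : Letter) : firstGroup :=
  ⟨s.perm, Subgroup.subset_closure ⟨s, rfl⟩⟩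

theorem Letter.elem_mul_self (s : Letter) : s.elem * s.elem = 1 :=
  Subtype.ext (Equiv.ext fun u => s.act_involutive u)

/-- The element of the first Grigorchuk group represented by a word. -/
def eval (w : List Letter) : firstGroup := (w.map Letter.elem).prod

@[simp] theorem eval_nil : eval [] = 1 := rfl

@[simp] theorem eval_append (w v : List Letter) : eval (w ++ v) = eval w * eval v := by
  simp [eval]

theorem eval_cons (s : Letter) (w : List Letter) : eval (s :: w) = s.elem * eval w := by
  simp [eval]

theorem eval_reverse (w : List Letter) : eval w.reverse = (eval w)⁻¹ := by
  induction w with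
  | nil => simp
  | cons s w ih =>
    rw [List.reverse_cons, eval_append, ih, eval_cons, eval_cons, mul_inv_rev, eval_nil, mul_one,
      inv_eq_of_mul_eq_one_left s.elem_mul_self]

theorem eval_cons_apply (s : Letter) (w : List Letter) (u : List Bool) :
    (eval (s :: w)).1 u = s.act ((eval w).1 u) := by
  rw [eval_cons]; rfl

theorem eval_append_apply (w v : List Letter) (u : List Bool) :
    (eval (w ++ v)).1 u = (eval w).1 ((eval v).1 u) := by
  rw [eval_append]; rfl

theorem eval_nil_apply (u : List Bool) : (eval []).1 u = u := rfl

theorem length_apply (g : firstGroup) (u : List Bool) : (g.1 u).length = u.length :=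
  (firstGroup_le_treeAut g.2).1 u

theorem prefix_apply_iff (g : firstGroup) (u v : List Bool) : g.1 u <+: g.1 v ↔ u <+: v :=
  (firstGroup_le_treeAut g.2).2 u v

/-- The substitution `a ↦ aca`, `b ↦ d`, `c ↦ b`, `d ↦ c`, whose values act on the right half of
the tree as the original word does. -/
def Letter.subst : Letter → List Letter
  | .a => [.a, .c, .a]
  | .b => [.d]
  | .c => [.b]
  | .d => [.c]

/-- The action of `Letter.subst` on the left half of the tree. -/
def Letter.leftPart : Letter → List Letter
  | .a => [.d]
  | .b => []
  | .c => [.a]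
  | .d => [.a]

/-- `Letter.subst` on words. -/
def subst (w : List Letter) : List Letter := w.flatMap Letter.subst

theorem subst_append (w v : List Letter) : subst (w ++ v) = subst w ++ subst v := by
  simp [subst]

/-- Letter by letter: aca = (d, a), d = (1, b), b = (a, c), c = (a, d). -/
theorem eval_subst_true (w : List Letter) (u : List Bool) :
    (eval (subst w)).1 (true :: u) = true :: (eval w).1 u := by
  induction w with
  | nil => rfl
  | cons s w ih =>
    rw [subst, List.flatMap_cons, eval_append_apply, ← subst, ih, eval_cons_apply]
    cases s <;> rfl

theorem eval_subst_false (w : List Letter) (u : List Bool) :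
    (eval (subst w)).1 (false :: u) = false :: (eval (w.flatMap Letter.leftPart)).1 u := by
  induction w with
  | nil => rfl
  | cons s w ih =>
    rw [subst, List.flatMap_cons, eval_append_apply, ← subst, ih, List.flatMap_cons,
      eval_append_apply]
    cases s <;> rfl

/-- The eight maps `(x, u) ↦ (x + e, b ^ (i or j) u)`, which are the elements of `⟨a, d⟩`. -/
def dihedralMap (e i j : Bool) : List Bool → List Bool
  | [] => []
  | x :: u => (x ^^ e) :: bif (bif x then i else j) then Letter.b.act u else u

/-- The square fixes the first bit and acts on each half by a power of the involution b. -/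
theorem dihedralMap_pow_four (e i j : Bool) (u : List Bool) :
    dihedralMap e i j (dihedralMap e i j (dihedralMap e i j (dihedralMap e i j u))) = u := by
  have hb := Letter.b.act_involutive
  cases u with
  | nil => rfl
  | cons x u => cases x <;> cases e <;> cases i <;> cases j <;> simp [dihedralMap, hb _]

/-- Multiplying on the left by a flips `e`; multiplying by d = (1, b) toggles whichever of `i`, `j`
belongs to the half that is sent to the right. -/
theorem exists_eval_leftPart_eq (w : List Letter) :
    ∃ e i j, ∀ u, (eval (w.flatMap Letter.leftPart)).1 u = dihedralMap e i j u := by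
  have hb := Letter.b.act_involutive
  induction w with
  | nil =>
    refine ⟨false, false, false, fun u => ?_⟩
    cases u <;> simp [dihedralMap]
  | cons s w ih =>
    obtain ⟨e, i, j, h⟩ := ih
    have ha : ∀ u, Letter.a.act (dihedralMap e i j u) = dihedralMap (!e) i j u := by
      intro u
      cases u <;> simp [dihedralMap, Letter.act]
    cases s
    · refine ⟨e, i ^^ !e, j ^^ e, fun u => ?_⟩
      rw [List.flatMap_cons, eval_append_apply, h]
      change Letter.d.act _ = _
      cases u with
      | nil => rfl
      | cons x u =>
        cases x <;> cases e <;> cases i <;> cases j <;> simp [dihedralMap, Letter.act, hb _]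
    · exact ⟨e, i, j, h⟩
    all_goals
      refine ⟨!e, i, j, fun u => ?_⟩
      rw [List.flatMap_cons, eval_append_apply, h]
      exact ha u

theorem eval_leftPart_pow_four (w : List Letter) (u : List Bool) :
    (eval ((w ++ w ++ w ++ w).flatMap Letter.leftPart)).1 u = u := by
  obtain ⟨e, i, j, h⟩ := exists_eval_leftPart_eq w
  simp only [List.flatMap_append, eval_append_apply, h, dihedralMap_pow_four]

theorem iterate_subst_append (k : ℕ) (w v : List Letter) :
    subst^[k] (w ++ v) = subst^[k] w ++ subst^[k] v := by
  induction k with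
  | zero => rfl
  | succ k ih => rw [Function.iterate_succ_apply', ih, subst_append,
      Function.iterate_succ_apply', Function.iterate_succ_apply']

theorem eval_iterate_subst (k : ℕ) (w : List Letter) (u : List Bool) :
    (eval (subst^[k] w)).1 (List.replicate k true ++ u) =
      List.replicate k true ++ (eval w).1 u := by
  induction k with
  | zero => rfl
  | succ k ih =>
    rw [Function.iterate_succ_apply', List.replicate_succ, List.cons_append, eval_subst_true, ih]
    rfl

/-- Where `u` first leaves the rightmost ray, the element acts through the left part of a fourth
power, hence trivially. -/
theorem eval_iterate_subst_pow_four (k : ℕ) (w : List Letter) (u : List Bool)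
    (hu : ¬ List.replicate k true <+: u) : (eval (subst^[k] (w ++ w ++ w ++ w))).1 u = u := by
  induction k generalizing u with
  | zero => simp at hu
  | succ k ih =>
    rw [Function.iterate_succ_apply']
    rcases u with _ | ⟨_ | _, u⟩
    · exact List.length_eq_zero_iff.1 (length_apply _ _)
    · simp only [eval_subst_false, iterate_subst_append, eval_leftPart_pow_four]
    · rw [eval_subst_true, ih]
      simpa [List.replicate_succ, List.cons_prefix_cons] using hu

theorem exists_apply_replicate_eq (v : List Bool) :
    ∃ g : firstGroup, g.1 (List.replicate v.length true) = v := by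
  -- The induction needs words, since `subst` is defined on words and not on group elements.
  suffices h : ∃ w : List Letter, (eval w).1 (List.replicate v.length true) = v from
    h.imp' eval fun _ h => h
  induction v with
  | nil => exact ⟨[], rfl⟩
  | cons x v ih =>
    obtain ⟨w, hw⟩ := ih
    have h : (eval (subst w)).1 (List.replicate (x :: v).length true) = true :: v := by
      rw [List.length_cons, List.replicate_succ, eval_subst_true, hw]
    cases x
    · exact ⟨.a :: subst w, by rw [eval_cons_apply, h]; rfl⟩
    · exact ⟨subst w, h⟩

/-! ### Lengths under the substitution. -/

/-- The number of occurrences of `a` in a word. -/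
def countA (w : List Letter) : ℕ := w.countP fun s => s matches .a

theorem countA_subst (w : List Letter) : countA (subst w) = 2 * countA w := by
  induction w with
  | nil => rfl
  | cons s w ih =>
    simp only [countA, subst] at ih ⊢
    cases s <;> simp [Letter.subst, ih]
    lia

theorem length_subst (w : List Letter) : (subst w).length = 2 * countA w + w.length := by
  induction w with
  | nil => rfl
  | cons s w ih =>
    simp only [countA, subst] at ih ⊢
    cases s <;> simp [Letter.subst] at ih ⊢ <;> lia

/-- Only a gets longer, by two letters. If half the letters are a, the length doubles, and so does
the number of a's, so the balance persists. -/
theorem length_iterate_subst (k : ℕ) {w : List Letter} (hw : w.length = 2 * countA w) :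
    (subst^[k] w).length = 2 ^ k * w.length := by
  induction k generalizing w with
  | zero => simp
  | succ k ih =>
    have h1 := length_subst w
    have h2 := countA_subst w
    rw [Function.iterate_succ_apply, ih (by lia), pow_succ, mul_assoc]
    congr 1
    lia

/-! ### Non-commuting elements deep in the tree. -/

/-- A word for `(ab)⁴`. -/
def wordX : List Letter := [.a, .b] ++ [.a, .b] ++ [.a, .b] ++ [.a, .b]

/-- A word for `(ac)⁴`. -/
def wordY : List Letter := [.a, .c] ++ [.a, .c] ++ [.a, .c] ++ [.a, .c]

theorem exists_eval_wordX_wordY_ne :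
    ∃ u, (eval (wordX ++ wordY)).1 u ≠ (eval (wordY ++ wordX)).1 u := by
  refine ⟨[false, false, false, false], ?_⟩
  simp only [wordX, wordY, List.cons_append, List.nil_append, eval_cons_apply, eval_nil_apply]
  simp [Letter.act]

/-- `(ab)⁴` acting on the subtree of the rightmost vertex of level `k`. -/
def deepX (k : ℕ) : firstGroup := eval (subst^[k] wordX)

/-- `(ac)⁴` acting on the subtree of the rightmost vertex of level `k`. -/
def deepY (k : ℕ) : firstGroup := eval (subst^[k] wordY)

/-- The commutator of `deepX k` and `deepY k`. It has length `O(2 ^ k)`, and all finite quotients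
in which it is nontrivial have order at least `2 ^ 2 ^ k`. -/
def deepCommutator (k : ℕ) : firstGroup := ⁅deepX k, deepY k⁆

theorem deepCommutator_ne_one (k : ℕ) : deepCommutator k ≠ 1 := by
  rw [Ne, deepCommutator, commutatorElement_eq_one_iff_mul_comm]
  intro h
  obtain ⟨u, hu⟩ := exists_eval_wordX_wordY_ne
  rw [deepX, deepY, ← eval_append, ← eval_append, ← iterate_subst_append,
    ← iterate_subst_append] at h
  have h' := congrArg (fun g : firstGroup => g.1 (List.replicate k true ++ u)) h
  simp only [eval_iterate_subst] at h'
  exact hu (List.append_cancel_left h')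

/-! ### Disjoint supports and the order of finite quotients. -/

theorem conj_apply_of_not_prefix {k : ℕ} {x : firstGroup}
    (hx : ∀ u, ¬ List.replicate k true <+: u → x.1 u = u) (g : firstGroup) {u : List Bool}
    (hu : ¬ g.1 (List.replicate k true) <+: u) : (g * x * g⁻¹).1 u = u := by
  have h : ¬ List.replicate k true <+: g.1⁻¹ u := by
    rw [← prefix_apply_iff g]
    simpa using hu
  change g.1 (x.1 (g.1⁻¹ u)) = u
  rw [hx _ h]
  simp

theorem commute_conj {k : ℕ} {x y : firstGroup}
    (hx : ∀ u, ¬ List.replicate k true <+: u → x.1 u = u)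
    (hy : ∀ u, ¬ List.replicate k true <+: u → y.1 u = u) {g h : firstGroup}
    (hgh : g.1 (List.replicate k true) ≠ h.1 (List.replicate k true)) :
    Commute (g * x * g⁻¹) (h * y * h⁻¹) := by
  have hd : (g * x * g⁻¹).1.Disjoint (h * y * h⁻¹).1 := by
    intro u
    by_cases hu : g.1 (List.replicate k true) <+: u
    · refine Or.inr (conj_apply_of_not_prefix hy h fun hu' => hgh ?_)
      exact (List.prefix_of_prefix_length_le hu hu' (by simp [length_apply])).eq_of_length
        (by simp [length_apply])
    · exact Or.inl (conj_apply_of_not_prefix hx g hu)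
  exact Subtype.ext hd.commute

theorem two_pow_two_pow_le_card_quotient {k : ℕ} {N : Subgroup firstGroup} [N.Normal]
    [N.FiniteIndex] (hN : deepCommutator k ∉ N) :
    2 ^ 2 ^ k ≤ Nat.card (firstGroup ⧸ N) := by
  have hex : ∀ v : List.Vector Bool k, ∃ g : firstGroup, g.1 (List.replicate k true) = v.1 := by
    rintro ⟨v, rfl⟩
    exact exists_apply_replicate_eq v
  choose g hg using hex
  have h := two_pow_card_le_of_commute_iff
    (fun v => ((g v * deepX k * (g v)⁻¹ : firstGroup) : firstGroup ⧸ N))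
    (fun v => ((g v * deepY k * (g v)⁻¹ : firstGroup) : firstGroup ⧸ N)) ?_ ?_
  · simpa [card_vector] using h
  · intro v w hvw
    refine Commute.map (commute_conj (k := k) (eval_iterate_subst_pow_four k _)
      (eval_iterate_subst_pow_four k _) ?_) (QuotientGroup.mk' N)
    rw [hg, hg]
    exact fun h => hvw (Subtype.ext h)
  -- If the images at one vertex commuted, a conjugate of `deepCommutator k` would lie in `N`, hence
  -- so would `deepCommutator k`.
  · intro v hv
    rw [← commutatorElement_eq_one_iff_commute] at hv
    have h1 : QuotientGroup.mk' N (g v * deepCommutator k * (g v)⁻¹) = 1 := by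
      rw [deepCommutator, conjugate_commutatorElement, map_commutatorElement]
      exact hv
    rw [map_mul, map_mul, map_inv, mul_inv_eq_one, mul_eq_left] at h1
    exact hN ((QuotientGroup.eq_one_iff _).1 h1)

/-- The action of the first Grigorchuk group on a level of the tree. -/
def levelAction (n : ℕ) : firstGroup →* Equiv.Perm (List.Vector Bool n) where
  toFun g := g.1.subtypePerm fun u => by rw [length_apply]
  map_one' := rfl
  map_mul' _ _ := rfl

theorem exists_normal_finiteIndex_notMem {g : firstGroup} (hg : g ≠ 1) :
    ∃ N : Subgroup firstGroup, N.Normal ∧ N.FiniteIndex ∧ g ∉ N := by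
  obtain ⟨u, hu⟩ : ∃ u, g.1 u ≠ u := by
    by_contra! h
    exact hg (Subtype.ext (Equiv.ext h))
  refine ⟨(levelAction u.length).ker, inferInstance, inferInstance, fun h => hu ?_⟩
  exact congrArg Subtype.val (DFunLike.congr_fun (MonoidHom.mem_ker.1 h)
    (⟨u, rfl⟩ : List.Vector Bool u.length))

theorem two_pow_two_pow_le_minQuotientCard (k : ℕ) :
    2 ^ 2 ^ k ≤ minQuotientCard (deepCommutator k) := by
  -- The infimum of the empty set is `0`, so residual finiteness is needed here.
  refine le_csInf ?_ ?_
  · obtain ⟨N, h1, h2, h3⟩ := exists_normal_finiteIndex_notMem (deepCommutator_ne_one k)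
    exact ⟨_, N, h1, h2, h3, rfl⟩
  · rintro m ⟨N, h1, h2, h3, rfl⟩
    exact two_pow_two_pow_le_card_quotient h3

/-! ### Word length of the commutators, and the growth bound. -/

theorem wordLength_eval_le {S : Set firstGroup} (hS : Subgroup.closure S = ⊤) {L : ℕ}
    (hL : ∀ s : Letter, wordLength S s.elem ≤ L) (w : List Letter) :
    wordLength S (eval w) ≤ L * w.length := by
  have h := wordLength_prod_le hS (w.map Letter.elem) (L := L) (by simpa using fun s _ => hL s)
  simpa [eval] using h

theorem wordLength_deepCommutator_le {S : Set firstGroup} (hS : Subgroup.closure S = ⊤) {L : ℕ}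
    (hL : ∀ s : Letter, wordLength S s.elem ≤ L) (k : ℕ) :
    wordLength S (deepCommutator k) ≤ L * (32 * 2 ^ k) := by
  -- The generators are involutions, so reversing a word inverts it. Four words of length 8 · 2^k
  -- give the factor 32.
  have h := wordLength_eval_le hS hL (subst^[k] wordX ++ subst^[k] wordY ++
    (subst^[k] wordX).reverse ++ (subst^[k] wordY).reverse)
  have hX : (subst^[k] wordX).length = 2 ^ k * 8 := length_iterate_subst k rfl
  have hY : (subst^[k] wordY).length = 2 ^ k * 8 := length_iterate_subst k rfl
  simp only [eval_append, eval_reverse, List.length_append, List.length_reverse, hX, hY] at h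
  rw [deepCommutator, commutatorElement_def]
  refine h.trans_eq ?_
  ring

end Grigorchuk

theorem mainTheorem5 (S : Finset Grigorchuk.firstGroup)
    (hS : Subgroup.closure (S : Set Grigorchuk.firstGroup) = ⊤) :
    ResidualGrowth.GrowthLE (fun n => 2 ^ n)
      (ResidualGrowth.rfGrowth (S : Set Grigorchuk.firstGroup)) := by
  obtain ⟨L, hL⟩ : ∃ L, ∀ s : Grigorchuk.Letter,
      ResidualGrowth.wordLength (S : Set Grigorchuk.firstGroup) s.elem ≤ L := by
    refine ⟨ResidualGrowth.wordLength (S : Set Grigorchuk.firstGroup) Grigorchuk.Letter.a.elem +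
      ResidualGrowth.wordLength (S : Set Grigorchuk.firstGroup) Grigorchuk.Letter.b.elem +
      ResidualGrowth.wordLength (S : Set Grigorchuk.firstGroup) Grigorchuk.Letter.c.elem +
      ResidualGrowth.wordLength (S : Set Grigorchuk.firstGroup) Grigorchuk.Letter.d.elem, ?_⟩
    intro s
    cases s <;> lia
  -- The choice of `k` below gives n ≤ 2^k ≤ 2n, and 64 = 32 · 2; the `+ 1` makes the constant
  -- positive without a bound on `L`.
  refine ⟨64 * L + 1, by lia, fun n hn => ?_⟩
  set k := Nat.log 2 n + 1 with hk
  have hlow : n ≤ 2 ^ k := (Nat.lt_pow_succ_log_self one_lt_two n).le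
  have hup : 2 ^ k ≤ 2 * n := by
    rw [hk, pow_succ, mul_comm]
    exact Nat.mul_le_mul_left 2 (Nat.pow_log_le_self 2 (by lia))
  have hlen : ResidualGrowth.wordLength (S : Set Grigorchuk.firstGroup)
      (Grigorchuk.deepCommutator k) ≤ (64 * L + 1) * n := by
    refine (Grigorchuk.wordLength_deepCommutator_le hS hL k).trans ?_
    calc L * (32 * 2 ^ k) ≤ L * (32 * (2 * n)) := by gcongr
      _ = 64 * L * n := by ring
      _ ≤ (64 * L + 1) * n := Nat.mul_le_mul_right n (by lia)
  calc 2 ^ n ≤ 2 ^ 2 ^ k := Nat.pow_le_pow_right two_pos hlow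
    _ ≤ ResidualGrowth.minQuotientCard (Grigorchuk.deepCommutator k) :=
      Grigorchuk.two_pow_two_pow_le_minQuotientCard k
    _ ≤ ResidualGrowth.rfGrowth (S : Set Grigorchuk.firstGroup) ((64 * L + 1) * n) :=
      ResidualGrowth.le_rfGrowth S.finite_toSet hS
        (Grigorchuk.deepCommutator_ne_one k) hlen
    _ ≤ (64 * L + 1) * ResidualGrowth.rfGrowth (S : Set Grigorchuk.firstGroup)
        ((64 * L + 1) * n) := Nat.le_mul_of_pos_left _ (by lia)
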